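/- Let $X$ be a finite set, let $C$ be a family of subsets of $X$ with $|C|\ge 2$, and let $Z = X\times\{0,1\}$. A concept $c\in C$ is consistent with $(x,b)\in Z$ if and only if ($b=1$ and $x\in c$) or ($b=0$ and $x\notin c$), and $c$ is consistent with a set $A\subseteq Z$ if it is consistent with every element of $A$. The order of a mapping $T:C\to 2^Z$ is $\max_{c\in C}|T(c)|$. An MLE-learner $L$ for $C$ is given by likelihoods $P(z|c)\ge 0$ ($z\in Z$, $c\in C$) such that $\sum_{z\in Z}P(z|c)=1$ for all $c \in C$, and $P(z|c)=0$ whenever $c$ is inconsistent with $z$; its prior on $C$ is uniform. Let $N^+(C,L)=\min_{c\in C}|\{z\in Z: P(z|c)>0\}|$. For $A\subseteq Z$ with $|A|=n\le N^+(C,L)$, let $$P(A|c)=\sum_{(z_1,\ldots,z_n)}\ \prod_{i=1}^{n}\frac{P(z_i|c)}{1-(P(z_1|c)+\cdots+P(z_{i-1}|c))},$$ where $(z_1,\ldots,z_n)$ ranges over all orderings of $A$; this is the probability that $n$-fold unordered sampling without replacement according to $P(\cdot|c)$ returns $A$. A teacher for $L$ is a mapping $T:C\to 2^Z$ such that, for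 every $c_0\in C$, $|T(c_0)|\le N^+(C,L)$ and $c_0$ is the unique maximizer of $c\mapsto P(T(c_0)|c)$ over $C$. The MLE-teaching dimension $\mathrm{MLETD}(C)=\mathrm{MLETD}^{\overline{O},\overline{R}}(C)$ (for unordered sampling without replacement) is the smallest order of a teacher for $L$, minimized over all MLE-learners $L$ for $C$ (a learner without a teacher contributes $\infty$). The antichain number $\mathrm{AN}(C)$ is the smallest order of a mapping $T:C\to 2^Z$ such that every $c\in C$ is consistent with $T(c)$ and $T(c_1)\not\subseteq T(c_2)$ for all distinct $c_1,c_2\in C$. The no-clash teaching dimension $\mathrm{NCTD}(C)$ is the smallest order of a mapping $T:C\to 2^Z$ such that every $c\in C$ is consistent with $T(c)$ and, for all distinct $c_1,c_2\in C$, $c_1$ is inconsistent with $T(c_2)$ or $c_2$ is inconsistent with $T(c_1)$. $\mathrm{VCdim}(C)$ is the Vapnik–Chervonenkis dimension of $C$. Then $$\mathrm{MLETD}(C)\le \mathrm{AN}(C),\qquad \mathrm{MLETD}(C)\le \mathrm{NCTD}(C),\qquad \mathrm{MLETD}(C)\le \mathrm{VCdim}(C).$$ -/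

import Mathlib

/-!
Teaching with maximum-likelihood learners. A concept class is a finite type `C`, the observations
form a finite type `Z`, and `cons c z` says that the concept `c` is consistent with the
observation `z`. Everything concerns unordered sampling without replacement, so the inputs of a
learner are the sets `A : Finset Z`.
-/

noncomputable section

namespace MLETeaching

/-- A concept is consistent with a set of observations if it is consistent with each of them. -/
def ConsistentWith {C Z : Type*} (cons : C → Z → Prop) (c : C) (A : Finset Z) : Prop :=
  ∀ z ∈ A, cons c z

/-- The order of a mapping `T : C → 2^Z`: the size of the largest set in its image. -/
def order {C Z : Type*} [Fintype C] (T : C → Finset Z) : ℕ :=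
  Finset.univ.sup fun c => (T c).card

/-- The probability that `n`-fold ordered sampling without replacement, with probability
parameters `q`, returns the repetition-free sequence `z`: the `i`-th draw is made from the
observations not drawn before, with the parameters renormalized. -/
def orderedProb {Z : Type*} (q : Z → ℝ) {n : ℕ} (z : Fin n → Z) : ℝ :=
  ∏ i : Fin n, q (z i) / (1 - ∑ j ∈ Finset.Iio i, q (z j))

open Classical in
/-- The probability that `|A|`-fold unordered sampling without replacement, with probability
parameters `q`, returns the set `A`: the sum over all orderings of `A`. -/
def unorderedProb {Z : Type*} (q : Z → ℝ) (A : Finset Z) : ℝ :=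
  ∑ e : Fin A.card ≃ {z // z ∈ A}, orderedProb q fun i => (e i : Z)

/-- A MAP-learner: priors `P(c) > 0` and conditional likelihoods `P(z | c) ≥ 0`, where
`P(z | c) = 0` whenever `c` is inconsistent with `z`. -/
structure MAPLearner {C Z : Type*} [Fintype C] [Fintype Z] (cons : C → Z → Prop) where
  prior : C → ℝ
  lik : C → Z → ℝ
  prior_pos : ∀ c, 0 < prior c
  prior_sum : ∑ c, prior c = 1
  lik_nonneg : ∀ c z, 0 ≤ lik c z
  lik_sum : ∀ c, ∑ z, lik c z = 1
  validity : ∀ c z, ¬ cons c z → lik c z = 0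

section Learner

variable {C Z : Type*} [Fintype C] [Fintype Z] {cons : C → Z → Prop}

/-- An MLE-learner is a MAP-learner with uniform priors. -/
def MAPLearner.IsMLE (L : MAPLearner cons) : Prop :=
  ∀ c, L.prior c = 1 / (Fintype.card C : ℝ)

open Classical in
/-- The observations to which `L` assigns positive likelihood under the concept `c`. -/
def MAPLearner.positive (L : MAPLearner cons) (c : C) : Finset Z :=
  Finset.univ.filter fun z => 0 < L.lik c z

/-- The smallest number of observations of positive likelihood, over all concepts; the learner
only accepts inputs of at most this size. -/
def MAPLearner.nPlus (L : MAPLearner cons) : ℕ :=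
  ⨅ c : C, (L.positive c).card

/-- The learner returns `c₀` on input `A`: the set `A` is not too large and `c₀` is the unique
maximizer of `P(c) * P(A | c)`. -/
def MAPLearner.Returns (L : MAPLearner cons) (A : Finset Z) (c₀ : C) : Prop :=
  A.card ≤ L.nPlus ∧
    ∀ c, c ≠ c₀ →
      L.prior c * unorderedProb (L.lik c) A < L.prior c₀ * unorderedProb (L.lik c₀) A

/-- A successful teacher for `L`. -/
def MAPLearner.IsTeacher (L : MAPLearner cons) (T : C → Finset Z) : Prop :=
  ∀ c₀, L.Returns (T c₀) c₀

/-- The teaching dimension given `L`: the smallest order of a teacher for `L`, and `⊤` if there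
is none. -/
def MAPLearner.teachingDim (L : MAPLearner cons) : ℕ∞ :=
  ⨅ (T : C → Finset Z) (_ : L.IsTeacher T), (order T : ℕ∞)

end Learner

/-- The MLE-teaching dimension: the minimum of the teaching dimensions given `L`, over all
MLE-learners `L`. -/
def mletd {C Z : Type*} [Fintype C] [Fintype Z] (cons : C → Z → Prop) : ℕ∞ :=
  ⨅ (L : MAPLearner cons) (_ : L.IsMLE), L.teachingDim

/-- Antichain mappings. -/
def IsAntichainMapping {C Z : Type*} (cons : C → Z → Prop) (T : C → Finset Z) : Prop :=
  (∀ c, ConsistentWith cons c (T c)) ∧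
    ∀ c₁ c₂, c₁ ≠ c₂ → ¬ T c₁ ⊆ T c₂ ∧ ¬ T c₂ ⊆ T c₁

/-- The antichain number: the smallest order of an antichain mapping. -/
def antichainNumber {C Z : Type*} [Fintype C] (cons : C → Z → Prop) : ℕ∞ :=
  ⨅ (T : C → Finset Z) (_ : IsAntichainMapping cons T), (order T : ℕ∞)

/-- Clash-free mappings. -/
def IsClashFree {C Z : Type*} (cons : C → Z → Prop) (T : C → Finset Z) : Prop :=
  (∀ c, ConsistentWith cons c (T c)) ∧
    ∀ c₁ c₂, c₁ ≠ c₂ →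
      ¬ ConsistentWith cons c₁ (T c₂) ∨ ¬ ConsistentWith cons c₂ (T c₁)

/-- The no-clash teaching dimension: the smallest order of a clash-free mapping. -/
def nctd {C Z : Type*} [Fintype C] (cons : C → Z → Prop) : ℕ∞ :=
  ⨅ (T : C → Finset Z) (_ : IsClashFree cons T), (order T : ℕ∞)

/-- Labeled examples: the concepts are the members of a family `C` of subsets of `X`, the
observations are the pairs in `X × {0, 1}`, and `c` is consistent with `(x, b)` if and only if
`b` is the label that `c` assigns to `x`. -/
def labeledCons {X : Type*} (C : Finset (Finset X)) (c : {c // c ∈ C}) (z : X × Bool) : Prop :=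
  (z.2 = true ∧ z.1 ∈ c.1) ∨ (z.2 = false ∧ z.1 ∉ c.1)

end MLETeaching

end

/-!
The three bounds all go through antichain mappings.

Let `T` be an antichain mapping. Take the learner whose likelihoods under `c` are proportional to
`1` on `T c`, to a small `ε > 0` on the other observations consistent with `c`, and to `0`
elsewhere. All consistent observations have positive likelihood, so that every `T c` is an
admissible input. Compare `P(T c | c)` with `P(T c | c')` for `c' ≠ c`, one ordering of `T c` at a
time. Under `c` every factor is at least `1 / |Z|`, so the product is bounded below independently
of `ε` (`pow_le_orderedProb`). Under `c'` some `z ∈ T c \ T c'` has to be drawn while some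
`t ∈ T c' \ T c` is still available, and this factor is at most `P(z | c') / P(t | c') ≤ ε`
(`orderedProb_le`). Hence `T` is a teacher once `ε` is small (`mletd_le_order`).

An injective mapping to consistent sets of one fixed size is an antichain mapping. A clash-free
mapping of order `d` can be padded with further consistent examples until all its values have
size `d`; it stays clash-free and is therefore injective.

For the VC-dimension `d`, such an injective mapping is a matching, in the bipartite graph of
consistency between concepts and labeled sets of size `d`, that saturates the concepts. Every
concept has degree `(|X| choose d)`. A labeled set `B` with domain `D` has at most this degree:
the concepts consistent with `B` agree on `D`, so the sets they shatter are disjoint from `D` and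
have at most `d` elements, and filling these up to size `d` with elements of `D` is injective;
by Pajor's inequality the number of concepts is at most the number of shattered sets. Double
counting now gives Hall's condition.
-/

noncomputable section

namespace MLETeaching

/-! ### Bounds for ordered sampling without replacement -/

section Sampling

variable {Z : Type*} [Fintype Z] {q : Z → ℝ} {n : ℕ} {z : Fin n → Z}

/-- An observation not drawn before the `i`-th draw is part of the mass by which the `i`-th
factor is renormalized. -/
lemma le_one_sub_sum_Iio (hq : ∀ y, 0 ≤ q y) (hsum : ∑ y, q y = 1)
    (hz : Function.Injective z) (i : Fin n) (t : Z) (ht : ∀ j < i, z j ≠ t) :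
    q t ≤ 1 - ∑ j ∈ Finset.Iio i, q (z j) := by
  classical
  have ht' : t ∉ (Finset.Iio i).image z := by
    simp only [Finset.mem_image, Finset.mem_Iio, not_exists, not_and]
    exact ht
  have h := Finset.sum_le_sum_of_subset_of_nonneg
    (Finset.subset_univ (insert t ((Finset.Iio i).image z))) (fun y _ _ => hq y)
  rw [Finset.sum_insert ht', Finset.sum_image hz.injOn, hsum] at h
  linarith

lemma apply_le_one_sub_sum_Iio (hq : ∀ y, 0 ≤ q y) (hsum : ∑ y, q y = 1)
    (hz : Function.Injective z) (i : Fin n) :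
    q (z i) ≤ 1 - ∑ j ∈ Finset.Iio i, q (z j) :=
  le_one_sub_sum_Iio hq hsum hz i (z i) fun _ hj h => hj.ne (hz h)

lemma pow_le_orderedProb (hq : ∀ y, 0 ≤ q y) (hsum : ∑ y, q y = 1)
    (hz : Function.Injective z) {p : ℝ} (hp : 0 < p) (hpz : ∀ i, p ≤ q (z i)) :
    p ^ n ≤ orderedProb q z := by
  have h : ∏ _i : Fin n, p ≤ orderedProb q z := by
    refine Finset.prod_le_prod (fun _ _ => hp.le) fun i _ => ?_
    have h1 := apply_le_one_sub_sum_Iio hq hsum hz i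
    have h2 : 0 ≤ ∑ j ∈ Finset.Iio i, q (z j) := Finset.sum_nonneg fun j _ => hq _
    have h3 := hpz i
    rw [le_div_iff₀ (by linarith)]
    nlinarith
  simpa using h

/-- Drawing `z i₀` while a much more likely `t` remains available until the end is unlikely. -/
lemma orderedProb_le (hq : ∀ y, 0 ≤ q y) (hsum : ∑ y, q y = 1)
    (hz : Function.Injective z) {ε : ℝ} {t : Z} (ht : ∀ j, z j ≠ t) (hqt : 0 < q t)
    {i₀ : Fin n} (hi₀ : q (z i₀) ≤ ε * q t) : orderedProb q z ≤ ε := by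
  have hden : ∀ i, q t ≤ 1 - ∑ j ∈ Finset.Iio i, q (z j) := fun i =>
    le_one_sub_sum_Iio hq hsum hz i t fun j _ => ht j
  have hε : 0 ≤ ε := nonneg_of_mul_nonneg_left ((hq _).trans hi₀) hqt
  rw [orderedProb, ← Finset.mul_prod_erase _ _ (Finset.mem_univ i₀)]
  have h1 : q (z i₀) / (1 - ∑ j ∈ Finset.Iio i₀, q (z j)) ≤ ε := by
    rw [div_le_iff₀ (hqt.trans_le (hden i₀))]
    exact hi₀.trans (mul_le_mul_of_nonneg_left (hden i₀) hε)
  have h2 : ∏ i ∈ Finset.univ.erase i₀, q (z i) / (1 - ∑ j ∈ Finset.Iio i, q (z j)) ≤ 1 :=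
    Finset.prod_le_one
      (fun i _ => div_nonneg (hq _) (hqt.le.trans (hden i)))
      fun i _ => div_le_one_of_le₀ (apply_le_one_sub_sum_Iio hq hsum hz i)
        (hqt.le.trans (hden i))
  have h3 : 0 ≤ ∏ i ∈ Finset.univ.erase i₀, q (z i) / (1 - ∑ j ∈ Finset.Iio i, q (z j)) :=
    Finset.prod_nonneg fun i _ => div_nonneg (hq _) (hqt.le.trans (hden i))
  calc _ ≤ ε * 1 := mul_le_mul h1 h2 h3 hε
    _ = ε := mul_one ε

end Sampling

/-! ### The learner of an antichain mapping -/

section Antichain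

variable {C Z : Type*}

open Classical in
/-- The unnormalized likelihood of `z` under `c` in the learner built from `T`: `1` on `T c`, `ε`
on the other observations consistent with `c`, and `0` elsewhere. -/
def weight (cons : C → Z → Prop) (T : C → Finset Z) (ε : ℝ) (c : C) (z : Z) : ℝ :=
  if z ∈ T c then 1 else if cons c z then ε else 0

variable {cons : C → Z → Prop} {T : C → Finset Z} {ε : ℝ}

lemma weight_of_mem {c : C} {z : Z} (h : z ∈ T c) : weight cons T ε c z = 1 := if_pos h

lemma weight_nonneg (hε : 0 ≤ ε) (c : C) (z : Z) : 0 ≤ weight cons T ε c z := by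
  unfold weight
  split_ifs <;> simp [hε]

lemma weight_pos (hε : 0 < ε) {c : C} {z : Z} (h : cons c z) : 0 < weight cons T ε c z := by
  unfold weight
  split_ifs <;> simp [hε]

lemma weight_le_one (hε : ε ≤ 1) (c : C) (z : Z) : weight cons T ε c z ≤ 1 := by
  unfold weight
  split_ifs <;> simp [hε]

lemma weight_le_of_notMem (hε : 0 ≤ ε) {c : C} {z : Z} (h : z ∉ T c) :
    weight cons T ε c z ≤ ε := by
  unfold weight
  rw [if_neg h]
  split_ifs <;> simp [hε]

lemma isAntichainMapping_of_injective {d : ℕ} (hT : ∀ c, ConsistentWith cons c (T c))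
    (hinj : Function.Injective T) (hd : ∀ c, (T c).card = d) : IsAntichainMapping cons T := by
  refine ⟨hT, fun c₁ c₂ hne => ⟨fun h => hne (hinj ?_), fun h => hne (hinj ?_)⟩⟩
  · exact Finset.eq_of_subset_of_card_le h (by rw [hd, hd])
  · exact (Finset.eq_of_subset_of_card_le h (by rw [hd, hd])).symm

variable [Fintype Z]

lemma one_le_sum_weight (hε : 0 ≤ ε) {c : C} (h : (T c).Nonempty) :
    1 ≤ ∑ z, weight cons T ε c z := by
  obtain ⟨z, hz⟩ := h
  rw [← weight_of_mem (cons := cons) (ε := ε) hz]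
  exact Finset.single_le_sum (fun y _ => weight_nonneg hε c y) (Finset.mem_univ z)

lemma sum_weight_le_card (hε : ε ≤ 1) (c : C) :
    ∑ z, weight cons T ε c z ≤ Fintype.card Z := by
  simpa using Finset.sum_le_sum fun z (_ : z ∈ Finset.univ) =>
    weight_le_one (cons := cons) (T := T) hε c z

variable [Fintype C]

/-- The learner with uniform priors whose likelihoods are the normalized weights. -/
def weightLearner [Nonempty C] (hT : ∀ c, ConsistentWith cons c (T c))
    (hne : ∀ c, (T c).Nonempty) (hε : 0 ≤ ε) : MAPLearner cons where
  prior _ := 1 / (Fintype.card C : ℝ)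
  lik c z := weight cons T ε c z / ∑ y, weight cons T ε c y
  prior_pos _ := by
    have : 0 < Fintype.card C := Fintype.card_pos
    positivity
  prior_sum := by simp
  lik_nonneg c z := div_nonneg (weight_nonneg hε c z)
    (zero_le_one.trans (one_le_sum_weight hε (hne c)))
  lik_sum c := by
    rw [← Finset.sum_div]
    exact div_self (zero_lt_one.trans_le (one_le_sum_weight hε (hne c))).ne'
  validity c z h := by
    have hz : z ∉ T c := fun hz => h (hT c z hz)
    simp [weight, hz, h]

open Classical in
/-- The teaching dimension is at most the order of any antichain mapping whose values are small
enough to be admissible inputs of a learner with full support. -/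
theorem mletd_le_order [Nontrivial C] (hT : IsAntichainMapping cons T)
    (hcard : ∀ c c', (T c).card ≤ (Finset.univ.filter (cons c')).card) :
    mletd cons ≤ order T := by
  have hne : ∀ c, (T c).Nonempty := fun c => by
    obtain ⟨c', hc'⟩ := exists_ne c
    obtain ⟨z, hz, -⟩ := Finset.not_subset.1 (hT.2 c c' hc'.symm).1
    exact ⟨z, hz⟩
  obtain ⟨c₁⟩ := (inferInstance : Nonempty C)
  have hN : 1 ≤ (Fintype.card Z : ℝ) := by
    have : Nonempty Z := ⟨(hne c₁).choose⟩
    exact_mod_cast Fintype.card_pos (α := Z)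
  set N : ℝ := (Fintype.card Z : ℝ)
  have hNpos : 0 < N := zero_lt_one.trans_le hN
  set p : ℝ := 1 / N
  have hp0 : 0 < p := by positivity
  have hp1 : p ≤ 1 := (div_le_one hNpos).2 hN
  -- Orderings have at most `|Z|` factors, so `ε` lies below every product under the true concept.
  set ε : ℝ := p ^ Fintype.card Z / 2
  have hpow : 0 < p ^ Fintype.card Z := by positivity
  have hε0 : 0 < ε := by positivity
  have hεlt : ε < p ^ Fintype.card Z := half_lt_self hpow
  have hε1 : ε ≤ 1 := hεlt.le.trans (pow_le_one₀ hp0.le hp1)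
  let L : MAPLearner cons := weightLearner hT.1 hne hε0.le
  have hS : ∀ c, 0 < ∑ y, weight cons T ε c y := fun c =>
    zero_lt_one.trans_le (one_le_sum_weight hε0.le (hne c))
  have hteach : L.IsTeacher T := by
    refine fun c₀ => ⟨le_ciInf fun c => (hcard c₀ c).trans (Finset.card_le_card fun z hz => ?_),
      fun c hc => ?_⟩
    · simp only [Finset.mem_filter, Finset.mem_univ, true_and] at hz
      simp only [MAPLearner.positive, Finset.mem_filter, Finset.mem_univ, true_and]
      exact div_pos (weight_pos hε0 hz) (hS c)
    · refine mul_lt_mul_of_pos_left ?_ (L.prior_pos c₀)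
      obtain ⟨t, ht, htA⟩ := Finset.not_subset.1 (hT.2 c c₀ hc).1
      obtain ⟨y, hyA, hy⟩ := Finset.not_subset.1 (hT.2 c c₀ hc).2
      refine Finset.sum_lt_sum_of_nonempty ⟨(T c₀).equivFin.symm, Finset.mem_univ _⟩
        fun e _ => ?_
      have hinj : Function.Injective fun i => (e i : Z) :=
        Subtype.val_injective.comp e.injective
      have hupper : orderedProb (L.lik c) (fun i => (e i : Z)) ≤ ε := by
        refine orderedProb_le (L.lik_nonneg c) (L.lik_sum c) hinj (t := t)
          (fun j h => htA (h ▸ (e j).2)) ?_ (i₀ := e.symm ⟨y, hyA⟩) ?_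
        · exact div_pos (by rw [weight_of_mem ht]; exact zero_lt_one) (hS c)
        · change weight cons T ε c _ / _ ≤ ε * (weight cons T ε c t / _)
          rw [weight_of_mem ht, ← mul_div_assoc, mul_one, Equiv.apply_symm_apply]
          exact div_le_div_of_nonneg_right (weight_le_of_notMem hε0.le hy) (hS c).le
      have hlower : p ^ (T c₀).card ≤ orderedProb (L.lik c₀) (fun i => (e i : Z)) := by
        refine pow_le_orderedProb (L.lik_nonneg c₀) (L.lik_sum c₀) hinj hp0 fun i => ?_
        change p ≤ weight cons T ε c₀ _ / _
        rw [weight_of_mem (e i).2]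
        exact one_div_le_one_div_of_le (hS c₀) (sum_weight_le_card hε1 c₀)
      calc _ ≤ ε := hupper
        _ < p ^ Fintype.card Z := hεlt
        _ ≤ p ^ (T c₀).card := pow_le_pow_of_le_one hp0.le hp1 (Finset.card_le_univ _)
        _ ≤ _ := hlower
  exact (iInf₂_le L fun _ => rfl).trans (iInf₂_le T hteach)

end Antichain

/-! ### Labeled examples -/

section Labeled

variable {X : Type*} [Fintype X] [DecidableEq X] {C : Finset (Finset X)}

open Classical in
/-- The labeled examples with which the concept `c` is consistent, that is, the graph of its
indicator function. -/
def labeledGraph (C : Finset (Finset X)) (c : {c // c ∈ C}) : Finset (X × Bool) :=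
  Finset.univ.filter (labeledCons C c)

omit [DecidableEq X] in
lemma mem_labeledGraph {c : {c // c ∈ C}} {z : X × Bool} :
    z ∈ labeledGraph C c ↔ labeledCons C c z := by
  simp [labeledGraph]

omit [Fintype X] in
lemma labeledCons_iff {c : {c // c ∈ C}} {z : X × Bool} :
    labeledCons C c z ↔ z.2 = decide (z.1 ∈ c.1) := by
  obtain ⟨x, b⟩ := z
  cases b <;> simp [labeledCons]

omit [DecidableEq X] in
lemma consistentWith_iff_subset {c : {c // c ∈ C}} {A : Finset (X × Bool)} :
    ConsistentWith (labeledCons C) c A ↔ A ⊆ labeledGraph C c :=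
  forall₂_congr fun _ _ => mem_labeledGraph.symm

lemma injOn_fst_labeledGraph (c : {c // c ∈ C}) :
    Set.InjOn Prod.fst (labeledGraph C c : Set (X × Bool)) := by
  intro z hz w hw h
  rw [Finset.mem_coe, mem_labeledGraph, labeledCons_iff] at hz hw
  exact Prod.ext h (by rw [hz, hw, h])

lemma card_labeledGraph (c : {c // c ∈ C}) : (labeledGraph C c).card = Fintype.card X := by
  rw [← Finset.card_image_of_injOn (injOn_fst_labeledGraph c), ← Finset.card_univ]
  congr 1
  refine Finset.eq_univ_of_forall fun x => Finset.mem_image.2 ⟨(x, decide (x ∈ c.1)), ?_, rfl⟩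
  rw [mem_labeledGraph, labeledCons_iff]

/-- For labeled examples every consistent mapping has admissible values, since each concept is
consistent with exactly `|X|` examples. -/
lemma mletd_labeledCons_le_order (hC : 2 ≤ C.card) {T : {c // c ∈ C} → Finset (X × Bool)}
    (hT : IsAntichainMapping (labeledCons C) T) : mletd (labeledCons C) ≤ order T := by
  have : Nontrivial {c // c ∈ C} := by
    rw [← Fintype.one_lt_card_iff_nontrivial, Fintype.card_coe]
    omega
  refine mletd_le_order hT fun c c' => ?_
  calc (T c).card ≤ (labeledGraph C c).card :=
        Finset.card_le_card (consistentWith_iff_subset.1 (hT.1 c))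
    _ = (labeledGraph C c').card := by rw [card_labeledGraph, card_labeledGraph]

/-- A clash-free mapping can be padded to an antichain mapping all of whose values have the
size of the largest original value. -/
lemma IsClashFree.exists_isAntichainMapping {T : {c // c ∈ C} → Finset (X × Bool)}
    (hT : IsClashFree (labeledCons C) T) :
    ∃ T', IsAntichainMapping (labeledCons C) T' ∧ order T' ≤ order T := by
  have hsub : ∀ c, T c ⊆ labeledGraph C c := fun c => consistentWith_iff_subset.1 (hT.1 c)
  have hle : order T ≤ Fintype.card X := Finset.sup_le fun c _ =>
    (Finset.card_le_card (hsub c)).trans (card_labeledGraph c).le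
  have hex : ∀ c, ∃ B, T c ⊆ B ∧ B ⊆ labeledGraph C c ∧ B.card = order T := fun c =>
    Finset.exists_subsuperset_card_eq (hsub c)
      (Finset.le_sup (f := fun c => (T c).card) (Finset.mem_univ c))
      (hle.trans (card_labeledGraph c).ge)
  choose T' hTT' hT'sub hT'card using hex
  have hcons : ∀ c, ConsistentWith (labeledCons C) c (T' c) := fun c =>
    consistentWith_iff_subset.2 (hT'sub c)
  refine ⟨T', isAntichainMapping_of_injective hcons (fun c₁ c₂ h => ?_) hT'card,
    Finset.sup_le fun c _ => (hT'card c).le⟩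
  by_contra hne
  rcases hT.2 c₁ c₂ hne with h' | h'
  · exact h' fun z hz => hcons c₁ z (h ▸ hTT' c₂ hz)
  · exact h' fun z hz => hcons c₂ z (h ▸ hTT' c₁ hz)

/-! ### The matching bound by the VC-dimension -/

lemma vcDim_le_card_univ (C : Finset (Finset X)) : C.vcDim ≤ Fintype.card X :=
  Finset.sup_le fun S _ => Finset.card_le_univ S

/-- Sets of size at most `|D|` that are disjoint from `D` are no more numerous than all sets of
size `|D|`. -/
lemma card_le_choose_of_disjoint {D : Finset X} {𝒮 : Finset (Finset X)}
    (hdisj : ∀ S ∈ 𝒮, Disjoint S D) (hcard : ∀ S ∈ 𝒮, S.card ≤ D.card) :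
    𝒮.card ≤ (Fintype.card X).choose D.card := by
  have hex : ∀ S : Finset X, ∃ F ⊆ D, F.card = D.card - S.card := fun S =>
    Finset.exists_subset_card_eq (Nat.sub_le _ _)
  choose F hFD hF using hex
  rw [← Finset.card_univ, ← Finset.card_powersetCard]
  refine Finset.card_le_card_of_injOn (fun S => S ∪ F S) (fun S hS => ?_) fun S hS S' hS' h => ?_
  · rw [Finset.mem_coe, Finset.mem_powersetCard]
    refine ⟨Finset.subset_univ _, ?_⟩
    rw [Finset.card_union_of_disjoint ((hdisj S hS).mono_right (hFD S)), hF]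
    have := hcard S hS
    omega
  · -- A set `S` disjoint from `D` is recovered from `S ∪ F S` by removing `D`.
    have key : ∀ R ∈ 𝒮, (R ∪ F R) \ D = R := fun R hR => by
      rw [Finset.union_sdiff_distrib, Finset.sdiff_eq_empty_iff_subset.2 (hFD R),
        Finset.union_empty, Finset.sdiff_eq_self_of_disjoint (hdisj R hR)]
    rw [← key S hS, ← key S' hS']
    exact congrArg (· \ D) h

/-- The degree bound in the consistency graph: at most `(|X| choose d)` concepts are consistent
with a given realizable labeled set whose size is the VC-dimension `d`. -/
lemma card_consistent_le_choose {s : Finset {c // c ∈ C}} {B : Finset (X × Bool)}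
    (hB : B.card = C.vcDim) (hs : ∀ c ∈ s, B ⊆ labeledGraph C c) :
    s.card ≤ (Fintype.card X).choose C.vcDim := by
  rcases s.eq_empty_or_nonempty with rfl | ⟨c₀, hc₀⟩
  · simp
  set D : Finset X := B.image Prod.fst with hD
  have hDcard : D.card = C.vcDim := by
    rw [hD, Finset.card_image_of_injOn ((injOn_fst_labeledGraph c₀).mono (hs c₀ hc₀)), hB]
  set 𝒜 : Finset (Finset X) := s.map (Function.Embedding.subtype _) with h𝒜
  have h𝒜C : 𝒜 ⊆ C := fun A hA => by
    obtain ⟨c, -, rfl⟩ := Finset.mem_map.1 hA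
    exact c.2
  rw [← hDcard, ← Finset.card_map (Function.Embedding.subtype _)]
  refine (Finset.card_le_card_shatterer 𝒜).trans (card_le_choose_of_disjoint ?_ ?_)
  · intro S hS
    rw [Finset.mem_shatterer] at hS
    rw [Finset.disjoint_left]
    intro x hxS hxD
    obtain ⟨z, hzB, rfl⟩ := Finset.mem_image.1 hxD
    -- A shattered set contains a point in one concept and omits it in another.
    obtain ⟨A, hA, hSA⟩ := hS (Finset.Subset.refl S)
    obtain ⟨A', hA', hSA'⟩ := hS (Finset.empty_subset S)
    obtain ⟨c, hc, rfl⟩ := Finset.mem_map.1 hA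
    obtain ⟨c', hc', rfl⟩ := Finset.mem_map.1 hA'
    have h1 : z.1 ∈ c.1 := Finset.inter_eq_left.1 hSA hxS
    have h2 : z.1 ∉ c'.1 := fun h =>
      Finset.notMem_empty z.1 (hSA' ▸ Finset.mem_inter.2 ⟨hxS, h⟩)
    have e1 := labeledCons_iff.1 (mem_labeledGraph.1 (hs c hc hzB))
    have e2 := labeledCons_iff.1 (mem_labeledGraph.1 (hs c' hc' hzB))
    rw [e1] at e2
    simp [h1, h2] at e2
  · intro S hS
    rw [hDcard]
    exact ((Finset.mem_shatterer.1 hS).mono_left h𝒜C).card_le_vcDim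

/-- By Hall's theorem, concepts can be matched injectively to consistent labeled sets of size
equal to the VC-dimension. -/
lemma exists_isAntichainMapping_order_le_vcDim (C : Finset (Finset X)) :
    ∃ T, IsAntichainMapping (labeledCons C) T ∧ order T ≤ C.vcDim := by
  classical
  have hpos : 0 < (Fintype.card X).choose C.vcDim := Nat.choose_pos (vcDim_le_card_univ C)
  obtain ⟨T, hinj, hT⟩ := (Finset.all_card_le_biUnion_card_iff_exists_injective
    fun c : {c // c ∈ C} => (labeledGraph C c).powersetCard C.vcDim).1 fun s => by
      refine Nat.le_of_mul_le_mul_right (Finset.card_mul_le_card_mul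
        (fun c B => B ∈ (labeledGraph C c).powersetCard C.vcDim)
        (fun c hc => ?_) fun B hB => ?_) hpos
      · rw [← card_labeledGraph c, ← Finset.card_powersetCard]
        exact Finset.card_le_card fun B hB => Finset.mem_filter.2
          ⟨Finset.mem_biUnion.2 ⟨c, hc, hB⟩, hB⟩
      · obtain ⟨c₀, -, hB₀⟩ := Finset.mem_biUnion.1 hB
        exact card_consistent_le_choose (Finset.mem_powersetCard.1 hB₀).2 fun c hc =>
          (Finset.mem_powersetCard.1 (Finset.mem_filter.1 hc).2).1
  have hcard : ∀ c, (T c).card = C.vcDim := fun c => (Finset.mem_powersetCard.1 (hT c)).2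
  exact ⟨T, isAntichainMapping_of_injective
    (fun c => consistentWith_iff_subset.2 (Finset.mem_powersetCard.1 (hT c)).1) hinj hcard,
    Finset.sup_le fun c _ => (hcard c).le⟩

end Labeled

end MLETeaching

end

/-- For labeled-example classes, the MLE-teaching dimension is at most the antichain number, the
no-clash teaching dimension and the VC-dimension. -/
theorem mainTheorem6 {X : Type*} [Fintype X] [DecidableEq X] (C : Finset (Finset X))
    (hC : 2 ≤ C.card) :
    MLETeaching.mletd (MLETeaching.labeledCons C) ≤
        MLETeaching.antichainNumber (MLETeaching.labeledCons C) ∧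
      MLETeaching.mletd (MLETeaching.labeledCons C) ≤
        MLETeaching.nctd (MLETeaching.labeledCons C) ∧
      MLETeaching.mletd (MLETeaching.labeledCons C) ≤ (C.vcDim : ℕ∞) := by
  refine ⟨le_iInf₂ fun T hT => MLETeaching.mletd_labeledCons_le_order hC hT,
    le_iInf₂ fun T hT => ?_, ?_⟩
  · obtain ⟨T', hT', hle⟩ := hT.exists_isAntichainMapping
    exact (MLETeaching.mletd_labeledCons_le_order hC hT').trans (by exact_mod_cast hle)
  · obtain ⟨T, hT, hle⟩ := MLETeaching.exists_isAntichainMapping_order_le_vcDim C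
    exact (MLETeaching.mletd_labeledCons_le_order hC hT).trans (by exact_mod_cast hle)
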